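/- Conventions. Graphs are finite, simple and undirected. An embedding of graphs is an injective map of vertex sets that preserves both adjacency and non-adjacency. A graph-type is a triple $\mathbb{T}=(\Delta,\iota,\Theta)$, where $\Delta,\Theta$ are graphs and $\iota:\Delta\hookrightarrow\Theta$ is an embedding; its order is the pair $(|V(\Delta)|,|V(\Theta)|)$. A graph $\Gamma$ is $\mathbb{T}$-regular if the number of embeddings $\hat\kappa:\Theta\hookrightarrow\Gamma$ with $\hat\kappa\circ\iota=\kappa$ is the same for all embeddings $\kappa:\Delta\hookrightarrow\Gamma$. The graph $\Gamma$ is $(m,n)$-regular if it is $\mathbb{T}$-regular for every graph-type $\mathbb{T}$ of order $(k,l)$ with $k\le m$ and $k\le l\le n$. It is $k$-isoregular if for every set $X$ of at most $k$ vertices the number of vertices outside $X$ that are adjacent to every element of $X$ depends only on the isomorphism type of the subgraph induced by $X$. A partial quadrangle with parameters $(s,t,\mu)$, where $s,t,\mu$ are non-negative integers, consists of a finite set of points, a set of lines and an incidence relation between them such that every line is incident with exactly $s+1$ points; every point is incident with exactly $t+1$ lines; any two distinct points are incident with at most one common line; any three distinct pairwise collinear points are all incident with one line; and for any two distinct non-collinear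 points there are exactly $\mu$ points collinear with both. Here two distinct points are collinear if some line is incident with both. The point graph has the points as vertices, two distinct points being adjacent if and only if they are collinear. Theorem. Let $\Gamma$ be the point graph of a partial quadrangle, and suppose that $\Gamma$ is $3$-isoregular. Then $\Gamma$ is $(3,7)$-regular. -/

import Mathlib

universe w u v

/-! ### Graph-types and regularity conditions -/

/-- A graph-type: an embedding `ι` (injective, preserving and reflecting adjacency) of a finite graph
`baseGraph`, its basis, into a finite graph `topGraph`. -/
structure GraphType : Type (w + 1) where
  Base : Type w
  Top : Type w
  finite_base : Finite Base
  finite_top : Finite Top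
  baseGraph : SimpleGraph Base
  topGraph : SimpleGraph Top
  ι : baseGraph ↪g topGraph

/-- The type `T` has order `(m, n)`: its basis has `m` vertices and its ambient graph has `n`. -/
def GraphType.HasOrder (T : GraphType.{w}) (m n : ℕ) : Prop :=
  Nat.card T.Base = m ∧ Nat.card T.Top = n

/-- The number of embeddings of the ambient graph of `T` into `Γ` that extend the embedding `κ` of
the basis of `T`. -/
noncomputable def GraphType.numExtensions {V : Type u} (Γ : SimpleGraph V) (T : GraphType.{w})
    (κ : T.baseGraph ↪g Γ) : ℕ :=
  Nat.card {κ' : T.topGraph ↪g Γ // ∀ x, κ' (T.ι x) = κ x}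

namespace SimpleGraph

variable {V : Type u}

/-- `Γ` is `T`-regular: the number of extensions of an embedding `κ` of the basis does not depend
on `κ`. -/
def IsTypeRegular (Γ : SimpleGraph V) (T : GraphType.{w}) : Prop :=
  ∀ κ₁ κ₂ : T.baseGraph ↪g Γ,
    GraphType.numExtensions Γ T κ₁ = GraphType.numExtensions Γ T κ₂

/-- `[m, n]`-regularity: `T`-regularity for all graph-types `T` of order `(m, n)`. -/
def IsRegularClosedClosed (Γ : SimpleGraph V) (m n : ℕ) : Prop :=
  ∀ T : GraphType.{w}, T.HasOrder m n → Γ.IsTypeRegular T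

/-- `[m, n)`-regularity: `[m, l]`-regularity for all `m ≤ l ≤ n`. -/
def IsRegularClosedOpen (Γ : SimpleGraph V) (m n : ℕ) : Prop :=
  ∀ l, m ≤ l → l ≤ n → IsRegularClosedClosed.{w} Γ m l

/-- `(m, n)`-regularity: `[k, n)`-regularity for all `k ≤ m`. -/
def IsRegularOpenOpen (Γ : SimpleGraph V) (m n : ℕ) : Prop :=
  ∀ k ≤ m, IsRegularClosedOpen.{w} Γ k n

/-- `k`-isoregularity: for every set `X` of at most `k` vertices, the number of vertices outside `X`
adjacent to every element of `X` depends only on the isomorphism type of the subgraph induced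
by `X`. -/
def IsIsoregular (Γ : SimpleGraph V) (k : ℕ) : Prop :=
  ∀ X Y : Finset V, X.card ≤ k → Y.card ≤ k →
    Nonempty (Γ.induce (X : Set V) ≃g Γ.induce (Y : Set V)) →
      {v | v ∉ X ∧ ∀ x ∈ X, Γ.Adj v x}.ncard = {v | v ∉ Y ∧ ∀ y ∈ Y, Γ.Adj v y}.ncard

end SimpleGraph

/-! ### Incidence structures and partial quadrangles

An incidence structure with points `P` and lines `L` is given by its incidence relation
`I : P → L → Prop`. -/

/-- Two distinct points are collinear if some line goes through both of them. -/
def IsCollinear {P : Type u} {L : Type v} (I : P → L → Prop) (p q : P) : Prop :=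
  p ≠ q ∧ ∃ l, I p l ∧ I q l

/-- The point graph: the vertices are the points, and adjacency is collinearity. -/
def pointGraph {P : Type u} {L : Type v} (I : P → L → Prop) : SimpleGraph P where
  Adj p q := IsCollinear I p q
  symm := ⟨fun _ _ ⟨hne, l, hp, hq⟩ => ⟨hne.symm, l, hq, hp⟩⟩
  loopless := ⟨fun _ h => h.1 rfl⟩

/-- Partial linear spaces of order `(s, t)`. -/
structure IsPartialLinearSpace {P : Type u} {L : Type v} (I : P → L → Prop) (s t : ℕ) : Prop where
  ncard_points : ∀ l, {p | I p l}.ncard = s + 1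
  ncard_lines : ∀ p, {l | I p l}.ncard = t + 1
  line_unique : ∀ p q, p ≠ q → ∀ l m, I p l → I q l → I p m → I q m → l = m

/-- Partial quadrangles with parameters `(s, t, μ)`. -/
structure IsPartialQuadrangle {P : Type u} {L : Type v} (I : P → L → Prop) (s t μ : ℕ) : Prop
    extends IsPartialLinearSpace I s t where
  no_triangle : ∀ p q r, IsCollinear I p q → IsCollinear I q r → IsCollinear I p r →
    ∃ l, I p l ∧ I q l ∧ I r l
  ncard_common : ∀ p q, p ≠ q → ¬ IsCollinear I p q →
    {x | IsCollinear I x p ∧ IsCollinear I x q}.ncard = μ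

/-!
Only two properties of the point graph `Γ` matter: it is `3`-isoregular, and it is *diamond-free*,
i.e. two distinct common neighbours of adjacent vertices are adjacent (three pairwise collinear
points lie on a line, and two points on at most one line).

Let `Θ` be a graph with at most `7` vertices, at most `3` of which are roots, whose images in `Γ`
are prescribed. Let `x` be a vertex of `Θ` that is not a root, and suppose that `x` has at most
three neighbours `T` such that every further neighbour `w` of `x` is joined to both ends of some
edge inside `T`. Given a copy of `Θ - x` in `Γ`, a new vertex `v` adjacent to the image of `T` is
then adjacent to the images of all neighbours of `x`, since `Γ` is diamond-free. The number of such
`v` does not depend on the copy, by `3`-isoregularity. Hence the total number of rooted copies of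
all graphs `Θ'` that arise from `Θ` by adding edges at `x` is a constant multiple of the number of
rooted copies of `Θ - x` (`sum_ncard_rootedCopies`). An induction on the number of vertices, and,
for a fixed number, from graphs with more edges to graphs with fewer, shows that the number of
rooted copies of `Θ` depends only on the subgraph induced on the roots (`ncard_rootedCopies_eq`).

It remains to find `x` when `Θ` is diamond-free, as it is if it has a copy in `Γ`
(`IsDiamondFree.exists_spanned_neighbors`). Otherwise every non-root has degree at least `4`, and
any maximal clique through a non-root `x` misses at least two neighbours of `x`. Counting vertices
around an edge `xy` between non-roots then gives that `x` and `y` together dominate all of the `7`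
vertices and have a single common neighbour `r`, which has no other neighbours. Two further
non-roots turn out to be adjacent, and so they dominate all vertices as well; but they are not
adjacent to `r`.
-/

namespace SimpleGraph

/-! ### Diamond-free graphs -/

/-- A graph is diamond-free if it does not contain `K₄` minus an edge as an induced subgraph:
distinct common neighbours of two adjacent vertices are adjacent. -/
def IsDiamondFree {V : Type*} (G : SimpleGraph V) : Prop :=
  ∀ ⦃a b c d⦄, G.Adj a b → G.Adj c a → G.Adj c b → G.Adj d a → G.Adj d b → c ≠ d → G.Adj c d

/-- The vertex set `T` spans the neighbours of `x`: every neighbour of `x` lies in `T` or is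
adjacent to both ends of an edge inside `T`. In a diamond-free graph, common neighbours of `T` are
then adjacent to all these neighbours. -/
def SpansNeighbors {W : Type*} (G : SimpleGraph W) (x : W) (T : Finset W) : Prop :=
  (∀ w ∈ T, G.Adj x w) ∧
    ∀ w, G.Adj x w → w ∈ T ∨ ∃ y ∈ T, ∃ z ∈ T, G.Adj y z ∧ G.Adj w y ∧ G.Adj w z

section Spanning

variable {W : Type*} [Fintype W] {G : SimpleGraph W} [DecidableRel G.Adj]

lemma exists_spansNeighbors_of_degree_le {x : W} (h : G.degree x ≤ 3) :
    ∃ T : Finset W, T.card ≤ 3 ∧ G.SpansNeighbors x T :=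
  ⟨G.neighborFinset x, h, fun w hw => by simpa using hw, fun w hw => Or.inl (by simpa using hw)⟩

variable [DecidableEq W]

/-- If the neighbours of `x` other than `u` form a clique, then two of them, together with `u`
if it is a neighbour, span the neighbours of `x`. -/
lemma exists_spansNeighbors_of_clique {x : W} (u : W)
    (h : ∀ y z, G.Adj x y → G.Adj x z → y ≠ u → z ≠ u → y ≠ z → G.Adj y z) :
    ∃ T : Finset W, T.card ≤ 3 ∧ G.SpansNeighbors x T := by
  rcases le_or_gt (G.degree x) 3 with hd | hd
  · exact exists_spansNeighbors_of_degree_le hd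
  have h1 : 1 < ((G.neighborFinset x).erase u).card := by
    have := Finset.pred_card_le_card_erase (s := G.neighborFinset x) (a := u)
    rw [card_neighborFinset_eq_degree] at this
    omega
  obtain ⟨y, hy, z, hz, hyz⟩ := Finset.one_lt_card.1 h1
  simp only [Finset.mem_erase, mem_neighborFinset] at hy hz
  have hadj := h y z hy.2 hz.2 hy.1 hz.1 hyz
  refine ⟨({y, z, u} : Finset W).filter (G.Adj x), (Finset.card_filter_le _ _).trans
    Finset.card_le_three, fun w hw => (Finset.mem_filter.1 hw).2, fun w hw => ?_⟩
  by_cases hwT : w ∈ ({y, z, u} : Finset W)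
  · exact Or.inl (Finset.mem_filter.2 ⟨hwT, hw⟩)
  · simp only [Finset.mem_insert, Finset.mem_singleton, not_or] at hwT
    exact Or.inr ⟨y, by simp [hy.2], z, by simp [hz.2], hadj,
      h w y hw hy.2 hwT.2.2 hy.1 hwT.1, h w z hw hz.2 hwT.2.2 hz.1 hwT.2.1⟩

/-- If the neighbours of neither end of an edge `xy` can be spanned by three of them, then both ends
have degree at least `4`, and each has two neighbours outside the clique formed by `x`, `y` and
their common neighbours. In a graph on at most `7` vertices this leaves room for exactly one common
neighbour `r`, and every vertex is adjacent to `x` or `y`. -/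
lemma IsDiamondFree.adj_of_not_spansNeighbors (hG : G.IsDiamondFree) (hW : Fintype.card W ≤ 7)
    {x y : W} (hxy : G.Adj x y)
    (hx : ¬ ∃ T : Finset W, T.card ≤ 3 ∧ G.SpansNeighbors x T)
    (hy : ¬ ∃ T : Finset W, T.card ≤ 3 ∧ G.SpansNeighbors y T) :
    Fintype.card W = 7 ∧ (∀ w, G.Adj x w ∨ G.Adj y w) ∧
      ∃ r, G.Adj r x ∧ G.Adj r y ∧ ∀ w, G.Adj r w → w = x ∨ w = y := by
  have hdx : 4 ≤ G.degree x := by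
    by_contra h
    exact hx (exists_spansNeighbors_of_degree_le (by omega))
  have hdy : 4 ≤ G.degree y := by
    by_contra h
    exact hy (exists_spansNeighbors_of_degree_le (by omega))
  set C := G.neighborFinset x ∩ G.neighborFinset y with hC
  have hmC : ∀ w, w ∈ C ↔ G.Adj x w ∧ G.Adj y w := fun w => by simp [hC]
  have hcard := Finset.card_union_add_card_inter (G.neighborFinset x) (G.neighborFinset y)
  rw [card_neighborFinset_eq_degree, card_neighborFinset_eq_degree, ← hC] at hcard
  have hU := Finset.card_le_univ (G.neighborFinset x ∪ G.neighborFinset y)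
  -- The clique `C ∪ {x, y}` misses at least two neighbours of either end of the edge.
  have key : ∀ {a b : W}, G.Adj a b →
      (¬ ∃ T : Finset W, T.card ≤ 3 ∧ G.SpansNeighbors a T) →
      2 ≤ ((G.neighborFinset a \ G.neighborFinset b).erase b).card := by
    intro a b hab ha
    by_contra hlt
    obtain ⟨u, hu⟩ : ∃ u, (G.neighborFinset a \ G.neighborFinset b).erase b ⊆ {u} :=
      have : Nonempty W := ⟨a⟩
      Finset.card_le_one_iff_subset_singleton.1 (by omega)
    refine ha (exists_spansNeighbors_of_clique u fun p q hp hq hpu hqu hpq => ?_)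
    have hin : ∀ p, G.Adj a p → p ≠ u → p = b ∨ G.Adj b p := by
      intro p hp hpu
      by_contra hcon
      rw [not_or] at hcon
      exact hpu (by simpa using hu (by simp [hp, hcon.1, hcon.2] :
        p ∈ (G.neighborFinset a \ G.neighborFinset b).erase b))
    rcases hin p hp hpu with rfl | hp'
    · rcases hin q hq hqu with rfl | hq'
      · exact absurd rfl hpq
      · exact hq'
    · rcases hin q hq hqu with rfl | hq'
      · exact hp'.symm
      · exact hG hab hp.symm hp'.symm hq.symm hq'.symm hpq
  have hP := key hxy hx
  have hQ := key hxy.symm hy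
  have e1 := Finset.card_erase_of_mem (s := G.neighborFinset x \ G.neighborFinset y) (a := y)
    (by simp [hxy])
  have e2 := Finset.card_erase_of_mem (s := G.neighborFinset y \ G.neighborFinset x) (a := x)
    (by simp [hxy.symm])
  have e3 := Finset.card_sdiff_add_card_inter (G.neighborFinset x) (G.neighborFinset y)
  have e4 := Finset.card_sdiff_add_card_inter (G.neighborFinset y) (G.neighborFinset x)
  rw [Finset.inter_comm, ← hC, card_neighborFinset_eq_degree] at e4
  rw [← hC, card_neighborFinset_eq_degree] at e3
  have hC1 : C.card = 1 := by omega
  have hdom : ∀ w, G.Adj x w ∨ G.Adj y w := by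
    have := (Finset.card_eq_iff_eq_univ (G.neighborFinset x ∪ G.neighborFinset y)).1 (by omega)
    intro w
    have hw := Finset.mem_univ w
    rw [← this] at hw
    simpa using hw
  obtain ⟨r, hr⟩ := Finset.card_eq_one.1 hC1
  have hrC : G.Adj x r ∧ G.Adj y r := (hmC r).1 (by simp [hr])
  refine ⟨by omega, hdom, r, hrC.1.symm, hrC.2.symm, fun w hw => ?_⟩
  by_contra hcon
  rw [not_or] at hcon
  have hwC : w ∈ C := by
    rw [hmC]
    rcases hdom w with h | h
    · exact ⟨h, hG hrC.1 hxy.symm hrC.2 h.symm hw.symm (Ne.symm hcon.2)⟩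
    · exact ⟨hG hrC.2 hxy hrC.1 h.symm hw.symm (Ne.symm hcon.1), h⟩
  rw [hr, Finset.mem_singleton] at hwC
  exact hw.ne' hwC

/-- In a diamond-free graph on at most `7` vertices, some vertex outside a given proper subset of
size at most `3` has its neighbours spanned by at most three of them. -/
lemma IsDiamondFree.exists_spanned_neighbors (hG : G.IsDiamondFree) (hW : Fintype.card W ≤ 7)
    (B : Finset W) (hB : B.card ≤ 3) (hne : ∃ x, x ∉ B) :
    ∃ x ∉ B, ∃ T : Finset W, T.card ≤ 3 ∧ G.SpansNeighbors x T := by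
  by_contra hcon
  have hirr : ∀ x ∉ B, ¬ ∃ T : Finset W, T.card ≤ 3 ∧ G.SpansNeighbors x T :=
    fun x hx hT => hcon ⟨x, hx, hT⟩
  have hdeg : ∀ x ∉ B, 4 ≤ G.degree x := fun x hx => by
    by_contra h
    exact hirr x hx (exists_spansNeighbors_of_degree_le (by omega))
  obtain ⟨x, hx⟩ := hne
  obtain ⟨y, hxy, hy⟩ : ∃ y, G.Adj x y ∧ y ∉ B := by
    obtain ⟨y, hy, hyB⟩ := Finset.exists_mem_notMem_of_card_lt_card
      (lt_of_le_of_lt hB (hdeg x hx) : B.card < (G.neighborFinset x).card)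
    exact ⟨y, by simpa using hy, hyB⟩
  obtain ⟨h7, hdom, r, hrx, hry, hr⟩ :=
    hG.adj_of_not_spansNeighbors hW hxy (hirr x hx) (hirr y hy)
  have hE : 1 < ((Bᶜ.erase x).erase y).card := by
    rw [Finset.card_erase_of_mem (by simp [hxy.ne', hy]), Finset.card_erase_of_mem (by simp [hx]),
      Finset.card_compl]
    omega
  obtain ⟨z, hz, w, hw, hzw⟩ := Finset.one_lt_card.1 hE
  simp only [Finset.mem_erase, Finset.mem_compl] at hz hw
  have hrne : ∀ v ∉ B, v ≠ r := by
    rintro v hv rfl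
    have hsub : G.neighborFinset v ⊆ {x, y} := fun w hw => by
      simpa using hr w (by simpa using hw)
    have := (Finset.card_le_card hsub).trans Finset.card_le_two
    have := hdeg v hv
    rw [card_neighborFinset_eq_degree] at *
    omega
  have hrz : ¬ G.Adj z r := fun h => by rcases hr z h.symm with h | h <;> simp_all
  have hrw : ¬ G.Adj w r := fun h => by rcases hr w h.symm with h | h <;> simp_all
  -- `z` is not adjacent to `z`, to `r`, and to one of `x`, `y`, hence it is adjacent to the rest.
  have hzw' : G.Adj z w := by
    by_contra hn
    obtain ⟨a, ha, hza⟩ : ∃ a, (a = x ∨ a = y) ∧ ¬ G.Adj z a := by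
      by_contra hall
      push Not at hall
      exact hrz (hG hxy (hall x (Or.inl rfl)) (hall y (Or.inr rfl)) hrx hry (hrne z hz.2.2))
    have hsub : G.neighborFinset z ⊆ ({z, r, a, w} : Finset W)ᶜ := by
      intro v hv
      rw [mem_neighborFinset] at hv
      simp only [Finset.mem_compl, Finset.mem_insert, Finset.mem_singleton]
      rintro (rfl | rfl | rfl | rfl)
      exacts [hv.ne rfl, hrz hv, hza hv, hn hv]
    have hfour : ({z, r, a, w} : Finset W).card = 4 := by
      have hra : r ≠ a := by rcases ha with rfl | rfl; exacts [hrx.ne, hry.ne]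
      have haz : z ≠ a := by rcases ha with rfl | rfl; exacts [hz.2.1, hz.1]
      have haw : a ≠ w := by rcases ha with rfl | rfl; exacts [hw.2.1.symm, hw.1.symm]
      simp [hzw, haz, haw, hra, hrne z hz.2.2, (hrne w hw.2.2).symm]
    have hle := Finset.card_le_card hsub
    rw [Finset.card_compl, hfour, card_neighborFinset_eq_degree] at hle
    have := hdeg z hz.2.2
    omega
  obtain ⟨-, hdom', -⟩ := hG.adj_of_not_spansNeighbors hW hzw' (hirr z hz.2.2) (hirr w hw.2.2)
  rcases hdom' r with h | h
  · exact hrz h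
  · exact hrw h

end Spanning

/-! ### Counting rooted copies -/

/-- The rooted induced copies of `Θ` in `Γ`: the injective maps `f` that pull the graph `Γ` back
to `Θ` and have prescribed values `κ` at the roots `ι`. -/
def rootedCopies {B W V : Type*} (Γ : SimpleGraph V) (Θ : SimpleGraph W) (ι : B → W) (κ : B → V) :
    Set (W → V) :=
  {f | Function.Injective f ∧ Γ.comap f = Θ ∧ f ∘ ι = κ}

/-- The graphs obtained from `Θ` by adding edges at the vertex `x`. -/
def extensionsAt {W : Type*} (Θ : SimpleGraph W) (x : W) : Set (SimpleGraph W) :=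
  {Θ' | Θ ≤ Θ' ∧ ∀ a b, a ≠ x → b ≠ x → (Θ'.Adj a b ↔ Θ.Adj a b)}

lemma IsDiamondFree.comap {V W : Type*} {Γ : SimpleGraph V} (h : Γ.IsDiamondFree) {f : W → V}
    (hf : Function.Injective f) : (Γ.comap f).IsDiamondFree :=
  fun _ _ _ _ h1 h2 h3 h4 h5 hne => h h1 h2 h3 h4 h5 (hf.ne hne)

/-- The number of common neighbours of the image of a set of at most `k` vertices is the same for
all copies of a graph in a `k`-isoregular graph. -/
lemma IsIsoregular.ncard_common_eq {V W : Type*} {Γ : SimpleGraph V} {k : ℕ}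
    (h : Γ.IsIsoregular k) {T : Finset W} (hT : T.card ≤ k) {g₁ g₂ : W → V}
    (h₁ : Function.Injective g₁) (h₂ : Function.Injective g₂) (h12 : Γ.comap g₁ = Γ.comap g₂) :
    {v | ∀ w ∈ T, Γ.Adj v (g₁ w)}.ncard = {v | ∀ w ∈ T, Γ.Adj v (g₂ w)}.ncard := by
  classical
  have aux : ∀ g : W → V, {v | v ∉ T.image g ∧ ∀ x ∈ T.image g, Γ.Adj v x} =
      {v | ∀ w ∈ T, Γ.Adj v (g w)} := by
    intro g
    ext v
    simp only [Finset.mem_image, forall_exists_index, and_imp, forall_apply_eq_imp_iff₂,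
      Set.mem_ofPred_eq, and_iff_right_iff_imp]
    rintro hv ⟨w, hw, rfl⟩
    exact (hv w hw).ne rfl
  rw [← aux g₁, ← aux g₂]
  refine h _ _ (Finset.card_image_le.trans hT) (Finset.card_image_le.trans hT) ⟨?_⟩
  have e : ∀ g : W → V, Function.Injective g →
      Nonempty ((Γ.comap g).induce (T : Set W) ≃g Γ.induce (T.image g : Set V)) := by
    intro g hg
    refine ⟨⟨(Equiv.Set.image g (T : Set W) hg).trans (Equiv.setCongr (by simp)), ?_⟩⟩
    intro a b
    rfl
  exact (e g₁ h₁).some.symm.trans (h12 ▸ (e g₂ h₂).some)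

section Counting

variable {B W V : Type*} [Finite W] [Finite V] {Γ : SimpleGraph V} {Θ : SimpleGraph W}

/-- In a diamond-free `3`-isoregular graph, the number of vertices outside a copy `g` of `Θ - x`
that are adjacent to the images of all neighbours of `x` does not depend on `g`, if these
neighbours are spanned by at most three of them. -/
lemma exists_ncard_oneVertexExtensions_eq (hΓ : Γ.IsDiamondFree) (hiso : Γ.IsIsoregular 3)
    {x : W} {T : Finset W} (hT : T.card ≤ 3) (hx : Θ.SpansNeighbors x T) :
    ∃ c : ℕ, ∀ g : {w // w ≠ x} → V, Function.Injective g →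
      Γ.comap g = Θ.comap Subtype.val →
        {v | v ∉ Set.range g ∧ ∀ w, Θ.Adj x w.1 → Γ.Adj v (g w)}.ncard = c := by
  classical
  by_cases hex : ∃ g₀ : {w // w ≠ x} → V, Function.Injective g₀ ∧
    Γ.comap g₀ = Θ.comap Subtype.val
  swap
  · exact ⟨0, fun g h1 h2 => absurd ⟨g, h1, h2⟩ hex⟩
  obtain ⟨g₀, hg₀, hg₀'⟩ := hex
  -- Among the common neighbours of `T`, those in the copy itself are already determined by `Θ`.
  set T' : Finset {w // w ≠ x} := T.subtype (· ≠ x) with hT'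
  have hT'card : T'.card ≤ 3 := by
    rw [hT', Finset.card_subtype]
    exact (Finset.card_filter_le _ _).trans hT
  have key : ∀ g : {w // w ≠ x} → V, Function.Injective g → Γ.comap g = Θ.comap Subtype.val →
      {v | v ∉ Set.range g ∧ ∀ w, Θ.Adj x w.1 → Γ.Adj v (g w)}.ncard +
        {u : {w // w ≠ x} | ∀ w ∈ T', Θ.Adj u w}.ncard =
          {v | ∀ w ∈ T', Γ.Adj v (g w)}.ncard := by
    intro g hg hgΘ
    have hadj : ∀ a b, Γ.Adj (g a) (g b) ↔ Θ.Adj a b := fun a b => by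
      rw [← comap_adj (f := g), hgΘ, comap_adj]
    rw [← Set.ncard_image_of_injective _ hg, ← Set.ncard_union_eq]
    · congr 1
      ext v
      simp only [Set.mem_union, Set.mem_ofPred_eq, Set.mem_image]
      constructor
      · rintro (⟨-, hv⟩ | ⟨u, hu, rfl⟩) w hw
        · exact hv w (hx.1 _ (by simpa [hT'] using hw))
        · exact (hadj u w).2 (hu w hw)
      · intro hv
        by_cases hr : v ∈ Set.range g
        · obtain ⟨u, rfl⟩ := hr
          exact Or.inr ⟨u, fun w hw => (hadj u w).1 (hv w hw), rfl⟩
        · refine Or.inl ⟨hr, fun w hw => ?_⟩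
          rcases hx.2 w hw with h | ⟨y, hy, z, hz, hyz, hwy, hwz⟩
          · exact hv w (by simpa [hT'] using h)
          · have hyx := (hx.1 y hy).ne'
            have hzx := (hx.1 z hz).ne'
            refine hΓ ((hadj ⟨y, hyx⟩ ⟨z, hzx⟩).2 hyz) (hv _ (by simpa [hT'] using hy))
              (hv _ (by simpa [hT'] using hz)) ((hadj w _).2 hwy) ((hadj w _).2 hwz) ?_
            rintro rfl
            exact hr ⟨w, rfl⟩
    · rw [Set.disjoint_left]
      rintro v ⟨hv, -⟩ ⟨u, -, rfl⟩
      exact hv ⟨u, rfl⟩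
  refine ⟨{v | v ∉ Set.range g₀ ∧ ∀ w, Θ.Adj x w.1 → Γ.Adj v (g₀ w)}.ncard, fun g hg hgΘ => ?_⟩
  have h1 := key g hg hgΘ
  have h2 := key g₀ hg₀ hg₀'
  have h3 := hiso.ncard_common_eq hT'card hg hg₀ (hgΘ.trans hg₀'.symm)
  omega

/-- Extending a copy of `Θ - x` by a vertex adjacent to the images of all neighbours of `x` gives
a copy of a graph that arises from `Θ` by adding edges at `x`. -/
lemma sum_ncard_rootedCopies {x : W} {c : ℕ}
    (hc : ∀ g : {w // w ≠ x} → V, Function.Injective g → Γ.comap g = Θ.comap Subtype.val →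
      {v | v ∉ Set.range g ∧ ∀ w, Θ.Adj x w.1 → Γ.Adj v (g w)}.ncard = c)
    (ι : B → {w // w ≠ x}) (κ : B → V) :
    ∑ᶠ Θ' ∈ Θ.extensionsAt x, (Γ.rootedCopies Θ' (Subtype.val ∘ ι) κ).ncard =
      c * (Γ.rootedCopies (Θ.comap Subtype.val) ι κ).ncard := by
  classical
  have := Fintype.ofFinite W
  have := Fintype.ofFinite V
  set F : Finset (W → V) := Finset.univ.filter fun f => Function.Injective f ∧
    Γ.comap f ∈ Θ.extensionsAt x ∧ f ∘ Subtype.val ∘ ι = κ with hF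
  trans F.card
  · rw [finsum_mem_eq_finite_toFinset_sum _ (Set.toFinite _),
      Finset.card_eq_sum_card_fiberwise (f := fun f => Γ.comap f)
        (t := (Set.toFinite (Θ.extensionsAt x)).toFinset)]
    · refine Finset.sum_congr rfl fun Θ' hΘ' => ?_
      rw [← Set.ncard_coe_finset]
      congr 1
      ext f
      simp only [Set.Finite.mem_toFinset] at hΘ'
      simp only [rootedCopies, hF, Set.mem_ofPred_eq, Finset.coe_filter, Finset.mem_filter,
        Finset.mem_univ, true_and]
      constructor
      · rintro ⟨h1, rfl, h3⟩
        exact ⟨⟨h1, hΘ', h3⟩, rfl⟩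
      · rintro ⟨⟨h1, -, h3⟩, rfl⟩
        exact ⟨h1, rfl, h3⟩
    · intro f hf
      simp only [hF, Finset.coe_filter, Set.mem_ofPred_eq] at hf
      simpa using hf.2.2.1
  · rw [Finset.card_eq_sum_card_fiberwise (f := fun f => f ∘ Subtype.val)
        (t := (Set.toFinite (Γ.rootedCopies (Θ.comap Subtype.val) ι κ)).toFinset)]
    · rw [Finset.sum_const_nat (m := c), mul_comm, Set.ncard_eq_toFinset_card _ (Set.toFinite _)]
      intro g hg
      rw [Set.Finite.mem_toFinset] at hg
      obtain ⟨hg1, hg2, hg3⟩ := hg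
      have hadj : ∀ a b, Γ.Adj (g a) (g b) ↔ Θ.Adj a b := fun a b => by
        rw [← comap_adj (f := g), hg2, comap_adj]
      rw [← hc g hg1 hg2, ← Set.ncard_coe_finset]
      -- An extension `f` of `g` is determined by its value at `x`.
      refine Set.ncard_congr (fun f _ => f x) ?_ ?_ ?_
      · intro f hf
        simp only [hF, Finset.coe_filter, Finset.mem_filter, Finset.mem_univ, true_and,
          Set.mem_ofPred_eq] at hf
        obtain ⟨⟨h1, ⟨h2, -⟩, -⟩, rfl⟩ := hf
        refine ⟨?_, fun w hw => h2 hw⟩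
        rintro ⟨w, hw⟩
        exact w.2 (h1 hw)
      · intro f f' hf hf' hx
        simp only [Finset.coe_filter, Set.mem_ofPred_eq] at hf hf'
        funext w
        by_cases hw : w = x
        · rw [hw]; exact hx
        · exact congrFun (hf.2.trans hf'.2.symm) ⟨w, hw⟩
      · rintro v ⟨hv, hvadj⟩
        have fx : ∀ w (hw : w ≠ x), (if h : w = x then v else g ⟨w, h⟩) = g ⟨w, hw⟩ :=
          fun w hw => dif_neg hw
        refine ⟨fun w => if h : w = x then v else g ⟨w, h⟩, ?_, dif_pos rfl⟩
        simp only [hF, Finset.coe_filter, Finset.mem_filter, Finset.mem_univ, true_and,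
          Set.mem_ofPred_eq]
        refine ⟨⟨?_, ⟨?_, ?_⟩, ?_⟩, ?_⟩
        · intro a b hab
          by_cases ha : a = x <;> by_cases hb : b = x
          · rw [ha, hb]
          · simp only [ha, hb, dite_true, dite_false] at hab
            exact absurd ⟨_, hab.symm⟩ hv
          · simp only [ha, hb, dite_true, dite_false] at hab
            exact absurd ⟨_, hab⟩ hv
          · simp only [ha, hb, dite_false] at hab
            exact congrArg Subtype.val (hg1 hab)
        · intro a b hab
          rw [comap_adj]
          by_cases ha : a = x <;> by_cases hb : b = x
          · exact absurd (ha.trans hb.symm) hab.ne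
          · simp only [ha, hb, dite_true, dite_false]
            exact hvadj ⟨b, hb⟩ (ha ▸ hab)
          · simp only [ha, hb, dite_true, dite_false]
            exact (hvadj ⟨a, ha⟩ (hb ▸ hab.symm)).symm
          · simp only [ha, hb, dite_false]
            exact (hadj _ _).2 hab
        · intro a b ha hb
          rw [comap_adj, fx a ha, fx b hb]
          exact hadj _ _
        · rw [← hg3]
          funext b
          exact fx _ (ι b).2
        · funext w
          exact fx _ w.2
    · intro f hf
      simp only [hF, Finset.coe_filter, Set.mem_ofPred_eq, Finset.mem_univ, true_and] at hf
      obtain ⟨h1, ⟨h2, h3⟩, h4⟩ := hf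
      simp only [Set.Finite.coe_toFinset]
      refine ⟨h1.comp Subtype.val_injective, ?_, h4⟩
      ext a b
      exact h3 a b a.2 b.2

end Counting

/-- In a diamond-free `3`-isoregular graph, the number of copies of a graph with at most `7`
vertices, at most `3` of which are roots, depends only on the subgraph induced on the roots. -/
theorem ncard_rootedCopies_eq {B : Type*} {V : Type u} [Finite V] {Γ : SimpleGraph V}
    (hΓ : Γ.IsDiamondFree) (hiso : Γ.IsIsoregular 3) (hB : Nat.card B ≤ 3)
    {κ₁ κ₂ : B → V} (h₁ : Function.Injective κ₁) (h₂ : Function.Injective κ₂) :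
    ∀ (n : ℕ), n ≤ 7 → ∀ (W : Type w) [Finite W], Nat.card W = n →
      ∀ (Θ : SimpleGraph W) (ι : B → W), Function.Injective ι → Γ.comap κ₁ = Θ.comap ι →
        Γ.comap κ₂ = Θ.comap ι →
          (Γ.rootedCopies Θ ι κ₁).ncard = (Γ.rootedCopies Θ ι κ₂).ncard := by
  classical
  intro n
  induction n using Nat.strong_induction_on with | _ n ihn
  intro hn W _ hW Θ
  induction Θ using WellFoundedGT.induction with | _ Θ ihΘ
  intro ι hι e₁ e₂
  have := Fintype.ofFinite W
  have := Fintype.ofFinite V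
  rw [Nat.card_eq_fintype_card] at hW
  by_cases hsurj : Function.Surjective ι
  · -- If all vertices are roots, there is precisely one copy.
    set e := Equiv.ofBijective ι ⟨hι, hsurj⟩
    have one : ∀ κ : B → V, Function.Injective κ → Γ.comap κ = Θ.comap ι →
        (Γ.rootedCopies Θ ι κ).ncard = 1 := by
      intro κ hκ hκΘ
      rw [Set.ncard_eq_one]
      refine ⟨κ ∘ e.symm, Set.eq_singleton_iff_unique_mem.2 ⟨⟨hκ.comp e.symm.injective, ?_, ?_⟩, ?_⟩⟩
      · rw [← comap_comap, hκΘ, comap_comap]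
        have : ι ∘ e.symm = id := funext e.apply_symm_apply
        rw [this, comap_id]
      · funext b
        exact congrArg κ (e.symm_apply_apply b)
      · rintro f ⟨-, -, hf⟩
        rw [← hf]
        funext w
        exact (congrArg f (e.apply_symm_apply w)).symm
    rw [one κ₁ h₁ e₁, one κ₂ h₂ e₂]
  by_cases hΘ : Θ.IsDiamondFree
  swap
  · have none : ∀ κ : B → V, Γ.rootedCopies Θ ι κ = ∅ := by
      refine fun κ => Set.eq_empty_of_forall_notMem ?_
      rintro f ⟨hf, rfl, -⟩
      exact hΘ (hΓ.comap hf)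
    rw [none, none]
  have : Finite B := Finite.of_injective ι hι
  have := Fintype.ofFinite B
  obtain ⟨x, hx, T, hT, hxT⟩ := hΘ.exists_spanned_neighbors (hW.trans_le hn)
    (Finset.univ.image ι)
    (Finset.card_image_le.trans (by rwa [Finset.card_univ, ← Nat.card_eq_fintype_card]))
    (by simpa [Function.Surjective] using hsurj)
  have hxι : ∀ b, ι b ≠ x := by simpa using hx
  obtain ⟨ι', rfl⟩ : ∃ ι' : B → {w // w ≠ x}, ι = Subtype.val ∘ ι' :=
    ⟨fun b => ⟨ι b, hxι b⟩, rfl⟩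
  obtain ⟨c, hc⟩ := exists_ncard_oneVertexExtensions_eq hΓ hiso hT hxT
  have hsum₁ := sum_ncard_rootedCopies hc ι' κ₁
  have hsum₂ := sum_ncard_rootedCopies hc ι' κ₂
  have hcard : Nat.card {w // w ≠ x} = n - 1 := by
    rw [Nat.card_eq_fintype_card, Fintype.card_subtype_compl, hW, Fintype.card_subtype_eq]
  have hpos : 0 < n := hW ▸ Fintype.card_pos_iff.2 ⟨x⟩
  rw [ihn (n - 1) (by omega) (by omega) _ hcard (Θ.comap Subtype.val) ι' hι.of_comp e₁ e₂,
    ← hsum₂] at hsum₁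
  have hmem : Θ ∈ Θ.extensionsAt x := ⟨le_rfl, fun _ _ _ _ => Iff.rfl⟩
  rw [← Set.insert_sdiff_self_of_mem hmem, finsum_mem_insert _ (by simp) (Set.toFinite _),
    finsum_mem_insert _ (by simp) (Set.toFinite _)] at hsum₁
  have hrest : ∑ᶠ Θ' ∈ Θ.extensionsAt x \ {Θ},
      (Γ.rootedCopies Θ' (Subtype.val ∘ ι') κ₁).ncard =
        ∑ᶠ Θ' ∈ Θ.extensionsAt x \ {Θ},
          (Γ.rootedCopies Θ' (Subtype.val ∘ ι') κ₂).ncard := by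
    refine finsum_mem_congr rfl fun Θ' hΘ' => ?_
    have hroots : Θ.comap (Subtype.val ∘ ι') = Θ'.comap (Subtype.val ∘ ι') := by
      ext a b
      exact (hΘ'.1.2 _ _ (hxι a) (hxι b)).symm
    exact ihΘ Θ' (lt_of_le_of_ne hΘ'.1.1 (Ne.symm hΘ'.2)) _ hι (e₁.trans hroots)
      (e₂.trans hroots)
  rw [hrest] at hsum₁
  exact Nat.add_right_cancel hsum₁

lemma _root_.GraphType.numExtensions_eq_ncard_rootedCopies {V : Type u} (Γ : SimpleGraph V)
    (T : GraphType.{w}) (κ : T.baseGraph ↪g Γ) :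
    T.numExtensions Γ κ = (Γ.rootedCopies T.topGraph T.ι κ).ncard := by
  refine Nat.card_congr ⟨fun f => ⟨f.1, f.1.injective, f.1.comap_eq, funext f.2⟩,
    fun f => ⟨⟨⟨f.1, f.2.1⟩, ?_⟩, fun x => congrFun f.2.2.2 x⟩, fun f => rfl, fun f => rfl⟩
  intro a b
  have := congrArg (fun G => G.Adj a b) f.2.2.1
  exact iff_of_eq this

/-- Diamond-free `3`-isoregular finite graphs are `(3, 7)`-regular. -/
theorem IsDiamondFree.isRegularOpenOpen {V : Type u} [Finite V] {Γ : SimpleGraph V}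
    (hΓ : Γ.IsDiamondFree) (hiso : Γ.IsIsoregular 3) : IsRegularOpenOpen.{w} Γ 3 7 := by
  intro k hk l _ hl T hT κ₁ κ₂
  have := T.finite_top
  rw [T.numExtensions_eq_ncard_rootedCopies, T.numExtensions_eq_ncard_rootedCopies]
  exact ncard_rootedCopies_eq hΓ hiso (hT.1.trans_le hk) κ₁.injective κ₂.injective l hl T.Top hT.2
    T.topGraph T.ι T.ι.injective (κ₁.comap_eq.trans T.ι.comap_eq.symm)
    (κ₂.comap_eq.trans T.ι.comap_eq.symm)

end SimpleGraph

/-! ### Partial quadrangles -/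

/-- Two points that are collinear with both of two collinear points lie on the line through
these. -/
lemma IsPartialQuadrangle.isDiamondFree_pointGraph {P : Type u} {L : Type v} {I : P → L → Prop}
    {s t μ : ℕ} (hI : IsPartialQuadrangle I s t μ) : (pointGraph I).IsDiamondFree := by
  intro a b c d hab hca hcb hda hdb hcd
  obtain ⟨l, hlc, hla, hlb⟩ := hI.no_triangle c a b hca hab hcb
  obtain ⟨m, hmd, hma, hmb⟩ := hI.no_triangle d a b hda hab hdb
  obtain rfl := hI.line_unique a b hab.1 l m hla hlb hma hmb
  exact ⟨hcd, l, hlc, hmd⟩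

theorem mainTheorem1 {P : Type u} {L : Type v} [Finite P] (I : P → L → Prop) (s t μ : ℕ)
    (hI : IsPartialQuadrangle I s t μ) (hiso : (pointGraph I).IsIsoregular 3) :
    SimpleGraph.IsRegularOpenOpen.{w} (pointGraph I) 3 7 :=
  hI.isDiamondFree_pointGraph.isRegularOpenOpen hiso
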